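/- Let $M$ be a smooth (Hausdorff, finite-dimensional, real) manifold, let $P$ be a smooth bivector field on $M$ and $\psi$ a smooth differential $3$-form on $M$. Let $P^\sharp : T^*M \to TM$ be the map $P^\sharp\xi = i_\xi P$, i.e. $\langle \eta, P^\sharp\xi\rangle = P(\xi,\eta)$, where multivectors are evaluated on covectors by the determinant convention, $(x\wedge y)(\xi,\eta)=\xi(x)\eta(y)-\eta(x)\xi(y)$. For $1$-forms $\xi,\eta$ put $$[\xi,\eta]^{P} = L_{P^\sharp\xi}\eta - L_{P^\sharp\eta}\xi - \mathrm{d}(P(\xi,\eta)), \qquad [\xi,\eta]^{P,\psi} = [\xi,\eta]^{P} + i_{P^\sharp\xi\wedge P^\sharp\eta}\psi,$$ where $i_{x\wedge y} = i_x\circ i_y$, so that $i_{x\wedge y}\psi=\psi(y,x,\cdot)$. Let $[P,P]_{SN}$ be the Schouten–Nijenhuis bracket of $P$ with itself (the extension of the Lie bracket of vector fields as a graded biderivation, so that $[x\wedge y, x\wedge y]_{SN} = 2\,[x,y]\wedge x\wedge y$ for vector fields $x,y$), and let $(\wedge^3P^\sharp)(\psi)$ be the trivector field $(\xi,\eta,\zeta)\mapsto\psi(P^\sharp\xi,P^\sharp\eta,P^\sharp\zeta)$.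 Then $$P^\sharp[\xi,\eta]^{P,\psi} = [P^\sharp\xi,P^\sharp\eta]\quad\text{for all smooth } 1\text{-forms } \xi,\eta \text{ on } M$$ (the bracket on the right being the Lie bracket of vector fields) if and only if $$\tfrac12[P,P]_{SN} = (\wedge^3P^\sharp)(\psi),$$ that is, if and only if $P$ is a Poisson structure with background $\psi$. -/

import Mathlib

open scoped Manifold ContDiff Topology

noncomputable section

namespace PoissonBackground

/-! ### Multilinear algebra on one (finite-dimensional, real) vector space

A bivector on `V` is an element of `⋀² V`, viewed as an alternating bilinear form on the dual `V*`,
with the determinant convention `(v ∧ w)(α, β) = α v * β w - α w * β v`;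
a trivector is, likewise, an alternating trilinear form on `V*`. -/

section Linear

variable (V : Type*) [AddCommGroup V] [Module ℝ V] [TopologicalSpace V]

/-- The space of covectors `V*`. -/
abbrev Covector : Type _ := V →L[ℝ] ℝ

/-- The space `⋀² V` of bivectors. -/
abbrev Bivector : Type _ := (Covector V) [⋀^Fin 2]→L[ℝ] ℝ

/-- The space `⋀³ V` of trivectors. -/
abbrev Trivector : Type _ := (Covector V) [⋀^Fin 3]→L[ℝ] ℝ

variable {V}

theorem bivector_add_left (P : Bivector V) (a b c : Covector V) :
    P ![a + b, c] = P ![a, c] + P ![b, c] := by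
  simpa using P.toMultilinearMap.cons_add ![c] a b

theorem bivector_smul_left (P : Bivector V) (r : ℝ) (a c : Covector V) :
    P ![r • a, c] = r * P ![a, c] := by
  simpa using P.toMultilinearMap.cons_smul ![c] r a

theorem bivector_swap (P : Bivector V) (a b : Covector V) : P ![a, b] = - P ![b, a] := by
  have h := P.map_swap ![b, a] (show (0 : Fin 2) ≠ 1 by decide)
  refine Eq.trans ?_ h
  change P _ = P _
  congr 1
  ext i : 1
  fin_cases i <;> rfl

theorem bivector_add_right (P : Bivector V) (a b c : Covector V) :
    P ![a, b + c] = P ![a, b] + P ![a, c] := by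
  rw [bivector_swap, bivector_add_left, bivector_swap P b, bivector_swap P c]
  ring

theorem bivector_smul_right (P : Bivector V) (r : ℝ) (a c : Covector V) :
    P ![a, r • c] = r * P ![a, c] := by
  rw [bivector_swap, bivector_smul_left, bivector_swap P c]
  ring

/-- A covector as an alternating form of degree one. -/
def covectorForm (ξ : Covector V) : V [⋀^Fin 1]→L[ℝ] ℝ :=
  ContinuousAlternatingMap.ofSubsingleton ℝ V ℝ 0 ξ

/-- The interior product `i_v θ = θ(v, ·)` of a `2`-form, as a covector. -/
def interiorTwo (v : V) (θ : V [⋀^Fin 2]→L[ℝ] ℝ) : Covector V :=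
  θ.toContinuousMultilinearMap.toContinuousLinearMap ![v, 0] 1

/-- The interior product `i_{v ∧ w} ψ = i_v (i_w ψ) = ψ(w, v, ·)` of a `3`-form, with the
convention `i_{v ∧ w} = i_v ∘ i_w`. -/
def interiorWedge (v w : V) (ψ : V [⋀^Fin 3]→L[ℝ] ℝ) : Covector V :=
  ψ.toContinuousMultilinearMap.toContinuousLinearMap ![w, v, 0] 2

theorem interiorTwo_apply (v w : V) (θ : V [⋀^Fin 2]→L[ℝ] ℝ) : interiorTwo v θ w = θ ![v, w] := by
  change θ (Function.update ![v, 0] 1 w) = _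
  congr 1
  ext i : 1
  fin_cases i <;> rfl

theorem interiorWedge_apply (v w u : V) (ψ : V [⋀^Fin 3]→L[ℝ] ℝ) :
    interiorWedge v w ψ u = ψ ![w, v, u] := by
  change ψ (Function.update ![w, v, 0] 2 u) = _
  congr 1
  ext i : 1
  fin_cases i <;> rfl

variable [IsTopologicalAddGroup V] [ContinuousSMul ℝ V] [T2Space V] [FiniteDimensional ℝ V]

/-- The linear form `α ↦ P(ξ, α)` on covectors, i.e. the interior product `i_ξ P` before `V**` is
identified with `V`. -/
def contraction (P : Bivector V) (ξ : Covector V) : Module.Dual ℝ (Module.Dual ℝ V) where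
  toFun α := P ![ξ, LinearMap.toContinuousLinearMap α]
  map_add' α β := by rw [map_add, bivector_add_right]
  map_smul' c α := by rw [map_smul, bivector_smul_right]; rfl

/-- `P^♯ : V* → V`, `P^♯ ξ = i_ξ P`: the vector with `α (P^♯ ξ) = P(ξ, α)` for all `α`. -/
def sharp (P : Bivector V) : Covector V →L[ℝ] V :=
  LinearMap.toContinuousLinearMap
    { toFun := fun ξ => (Module.evalEquiv ℝ V).symm (contraction P ξ)
      map_add' := fun ξ η => by
        rw [← map_add]
        congr 1
        ext α
        exact bivector_add_left P ξ η _
      map_smul' := fun c ξ => by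
        rw [RingHom.id_apply, ← map_smul]
        congr 1
        ext α
        exact bivector_smul_left P c ξ _ }

/-- The property that characterizes `P^♯`. -/
theorem apply_sharp (P : Bivector V) (ξ α : Covector V) : α (sharp P ξ) = P ![ξ, α] := by
  have h := Module.apply_evalEquiv_symm_apply (R := ℝ) (M := V) (α : Module.Dual ℝ V)
    (contraction P ξ)
  exact h

/-- `(⋀³ P^♯)(ψ)`: the trivector `(ξ, η, ζ) ↦ ψ(P^♯ ξ, P^♯ η, P^♯ ζ)`. -/
def wedgeThreeSharp (P : Bivector V) (ψ : V [⋀^Fin 3]→L[ℝ] ℝ) : Trivector V :=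
  ψ.compContinuousLinearMap (sharp P)

end Linear

/-- The Schouten–Nijenhuis bracket of two bivector fields on a vector space:
`[P, Q](α, β, γ) = ∑ D_{P^♯ α} Q (β, γ) + D_{Q^♯ α} P (β, γ)`, the sum running over the cyclic
permutations of `α, β, γ`. In coordinates,
`[P, Q]^{ijk} = ∑ₗ P^{il} ∂ₗ Q^{jk} + Q^{il} ∂ₗ P^{jk} + (cyclic permutations of i, j, k)`.
(`alternatizeUncurryFin`, which also defines `extDeriv`, maps `f` to
`f α (β, γ) - f β (α, γ) + f γ (α, β)`.)
This is the biderivation extending the Lie bracket, `[X ∧ Y, Z ∧ W] =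
[X, Z] ∧ Y ∧ W - [X, W] ∧ Y ∧ Z - [Y, Z] ∧ X ∧ W + [Y, W] ∧ X ∧ Z`. -/
def schoutenVec {E : Type*} [NormedAddCommGroup E] [NormedSpace ℝ E] [FiniteDimensional ℝ E]
    (P Q : E → Bivector E) (y : E) : Trivector E :=
  ContinuousAlternatingMap.alternatizeUncurryFin
    ((fderiv ℝ Q y).comp (sharp (P y)) + (fderiv ℝ P y).comp (sharp (Q y)))

/-! ### Tensor fields on a manifold -/

section Manifold

variable {E : Type*} [NormedAddCommGroup E] [NormedSpace ℝ E] [FiniteDimensional ℝ E]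
  {M : Type*} [TopologicalSpace M] [ChartedSpace E M]

instance (x : M) : FiniteDimensional ℝ (TangentSpace 𝓘(ℝ, E) x) :=
  inferInstanceAs (FiniteDimensional ℝ E)

instance (x : M) : T2Space (TangentSpace 𝓘(ℝ, E) x) :=
  inferInstanceAs (T2Space E)

variable (E M)

/-- Fields of alternating `n`-forms on `M` (no regularity required). -/
abbrev FormField (n : ℕ) : Type _ := (x : M) → (TangentSpace 𝓘(ℝ, E) x) [⋀^Fin n]→L[ℝ] ℝ

/-- Fields of covectors on `M` (no regularity required). -/
abbrev CovectorField : Type _ := (x : M) → Covector (TangentSpace 𝓘(ℝ, E) x)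

/-- Fields of bivectors on `M` (no regularity required). -/
abbrev BivectorField : Type _ := (x : M) → Bivector (TangentSpace 𝓘(ℝ, E) x)

variable {E M}

/-- The expression of a field of forms in the preferred chart at `x₀`. -/
def chartForm {n : ℕ} (θ : FormField E M n) (x₀ : M) (y : E) : E [⋀^Fin n]→L[ℝ] ℝ :=
  (θ ((extChartAt 𝓘(ℝ, E) x₀).symm y)).compContinuousLinearMap
    (mfderiv 𝓘(ℝ, E) 𝓘(ℝ, E) (extChartAt 𝓘(ℝ, E) x₀).symm y)

/-- A smooth differential form: its expression in every chart is smooth. -/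
def SmoothForm {n : ℕ} (θ : FormField E M n) : Prop :=
  ∀ x₀ : M, ContDiffOn ℝ ∞ (chartForm θ x₀) (extChartAt 𝓘(ℝ, E) x₀).target

/-- A covector field as a field of alternating forms of degree one. -/
def toForm (ξ : CovectorField E M) : FormField E M 1 := fun x => covectorForm (ξ x)

/-- A smooth differential `1`-form. -/
def SmoothOneForm (ξ : CovectorField E M) : Prop := SmoothForm (toForm ξ)

/-- The expression of a bivector field in the preferred chart `φ` at `x₀`, i.e. its push-forward
`(α, β) ↦ P(φ* α, φ* β)` by `φ`. -/
def chartBivector (P : BivectorField E M) (x₀ : M) (y : E) : Bivector E :=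
  (P ((extChartAt 𝓘(ℝ, E) x₀).symm y)).compContinuousLinearMap
    (ContinuousLinearMap.precomp ℝ
      (mfderiv 𝓘(ℝ, E) 𝓘(ℝ, E) (extChartAt 𝓘(ℝ, E) x₀)
        ((extChartAt 𝓘(ℝ, E) x₀).symm y) :
          TangentSpace 𝓘(ℝ, E) ((extChartAt 𝓘(ℝ, E) x₀).symm y) →L[ℝ] E))

/-- A smooth bivector field: its expression in every chart is smooth. -/
def SmoothBivector (P : BivectorField E M) : Prop :=
  ∀ x₀ : M, ContDiffOn ℝ ∞ (chartBivector P x₀) (extChartAt 𝓘(ℝ, E) x₀).target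

/-- The exterior differential `dθ` of a form on `M`, computed at `x₀` in the chart at `x₀`. -/
def mextDeriv {n : ℕ} (θ : FormField E M n) : FormField E M (n + 1) := fun x₀ =>
  (extDeriv (chartForm θ x₀) (extChartAt 𝓘(ℝ, E) x₀ x₀)).compContinuousLinearMap
    (mfderiv 𝓘(ℝ, E) 𝓘(ℝ, E) (extChartAt 𝓘(ℝ, E) x₀) x₀ : TangentSpace 𝓘(ℝ, E) x₀ →L[ℝ] E)

/-- The differential `df` of a function on `M`. -/
def differential (f : M → ℝ) : CovectorField E M := fun x =>
  (mfderiv 𝓘(ℝ, E) 𝓘(ℝ, ℝ) f x : TangentSpace 𝓘(ℝ, E) x →L[ℝ] ℝ)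

/-- The Lie derivative of a `1`-form, `L_X η = i_X dη + d(i_X η)`. -/
def lieDerivative (X : (x : M) → TangentSpace 𝓘(ℝ, E) x) (η : CovectorField E M) :
    CovectorField E M := fun x =>
  interiorTwo (X x) (mextDeriv (toForm η) x) + differential (fun z => η z (X z)) x

/-- The vector field `P^♯ ξ`. -/
def sharpField (P : BivectorField E M) (ξ : CovectorField E M) :
    (x : M) → TangentSpace 𝓘(ℝ, E) x := fun x => sharp (P x) (ξ x)

/-- The Koszul bracket `[ξ, η]^P = L_{P^♯ ξ} η - L_{P^♯ η} ξ - d(P(ξ, η))`. -/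
def koszulBracket (P : BivectorField E M) (ξ η : CovectorField E M) : CovectorField E M :=
  fun x => lieDerivative (sharpField P ξ) η x - lieDerivative (sharpField P η) ξ x
    - differential (fun z => P z ![ξ z, η z]) x

/-- The twisted bracket `[ξ, η]^{P,ψ} = [ξ, η]^P + i_{P^♯ ξ ∧ P^♯ η} ψ`. -/
def twistedBracket (P : BivectorField E M) (ψ : FormField E M 3) (ξ η : CovectorField E M) :
    CovectorField E M := fun x =>
  koszulBracket P ξ η x + interiorWedge (sharpField P ξ x) (sharpField P η x) (ψ x)

/-- The Schouten–Nijenhuis bracket `[P, Q]_SN` of two bivector fields on `M`, computed at `x₀` in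
the chart at `x₀` and transported back to `T_{x₀} M`. -/
def schouten (P Q : BivectorField E M) (x₀ : M) : Trivector (TangentSpace 𝓘(ℝ, E) x₀) :=
  (schoutenVec (chartBivector P x₀) (chartBivector Q x₀)
      (extChartAt 𝓘(ℝ, E) x₀ x₀)).compContinuousLinearMap
    ((ContinuousLinearMap.precomp ℝ
      ((mfderiv 𝓘(ℝ, E) 𝓘(ℝ, E) (extChartAt 𝓘(ℝ, E) x₀) x₀ :
        TangentSpace 𝓘(ℝ, E) x₀ →L[ℝ] E).inverse) :
      Covector (TangentSpace 𝓘(ℝ, E) x₀) →L[ℝ] Covector E))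

/-- `P` is a Poisson structure with background `ψ`: `½ [P, P]_SN = (⋀³ P^♯)(ψ)`. -/
def IsPoissonWithBackground (P : BivectorField E M) (ψ : FormField E M 3) : Prop :=
  ∀ x : M, (1 / 2 : ℝ) • schouten P P x = wedgeThreeSharp (P x) (ψ x)

end Manifold

end PoissonBackground

end

noncomputable section

namespace PoissonBackground

/-! ### Pointwise algebra of `sharp` and the background term. -/

section Linear

variable {V : Type*} [AddCommGroup V] [Module ℝ V] [TopologicalSpace V]
  [IsTopologicalAddGroup V] [ContinuousSMul ℝ V] [T2Space V] [FiniteDimensional ℝ V]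

/-! Pair the defect `[P♯ξ, P♯η] - P♯[ξ, η]^{P,ψ}` with a covector `γ`. On a vector space, once
everything is expanded, all derivatives of `ξ` and `η` cancel. What remains is the alternating sum
of `D_{P♯ξ} P (η, γ)`, which is `½ [P, P]_SN (ξ, η, γ)` (`koszulVec_apply`,
`lieBracket_sharp_sub_sharp_koszulVec`). The background contributes `-ψ(P♯ξ, P♯η, P♯γ)`
(`apply_sharp_interiorWedge`).

Every ingredient is natural under charts, so the identity holds on `M`
(`apply_mlieBracket_sub_sharp_twistedBracket`). The defect is therefore tensorial: its value at `x`
depends only on `ξ x` and `η x`. Since every covector at `x` is the value of a global smooth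
`1`-form (`exists_smoothOneForm_eq`), the defect vanishes for all `ξ`, `η` exactly when the two
trivectors agree at every point. -/

theorem eq_of_forall_covector {v w : V} (h : ∀ α : Covector V, α v = α w) : v = w := by
  refine (Module.evalEquiv ℝ V).injective ?_
  ext α
  exact h (LinearMap.toContinuousLinearMap α)

/-- Two signs cancel: one from the skewness of `p` when `sharp p` is moved onto `c`, one from the
reversed order in `i_{v ∧ w} ψ = ψ(w, v, ·)`. -/
theorem apply_sharp_interiorWedge (p : Bivector V) (ψ : V [⋀^Fin 3]→L[ℝ] ℝ)
    (a b c : Covector V) :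
    c (sharp p (interiorWedge (sharp p a) (sharp p b) ψ)) = wedgeThreeSharp p ψ ![a, b, c] := by
  have h := ψ.map_swap ![sharp p a, sharp p b, sharp p c] (show (0 : Fin 3) ≠ 1 by decide)
  have h1 : ![sharp p a, sharp p b, sharp p c] ∘ Equiv.swap 0 1 =
      ![sharp p b, sharp p a, sharp p c] := by
    ext i : 1
    fin_cases i <;> rfl
  have h2 : wedgeThreeSharp p ψ ![a, b, c] = ψ ![sharp p a, sharp p b, sharp p c] := by
    refine congrArg ψ ?_
    ext i : 1
    fin_cases i <;> rfl
  rw [h1] at h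
  rw [apply_sharp, bivector_swap, ← apply_sharp, interiorWedge_apply, h2]
  exact neg_eq_iff_eq_neg.2 h

end Linear

/-! ### The identity on a vector space. -/

section Flat

variable {E : Type*} [NormedAddCommGroup E] [NormedSpace ℝ E]

theorem hasFDerivAt_bivector_apply {P : E → Bivector E} {P' : E →L[ℝ] Bivector E}
    {ξ η : E → Covector E} {ξ' η' : E →L[ℝ] Covector E} {y : E}
    (hP : HasFDerivAt P P' y) (hξ : HasFDerivAt ξ ξ' y) (hη : HasFDerivAt η η' y) :
    ∃ D : E →L[ℝ] ℝ, HasFDerivAt (fun z => P z ![ξ z, η z]) D y ∧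
      ∀ u, D u = P' u ![ξ y, η y] + P y ![ξ' u, η y] + P y ![ξ y, η' u] := by
  have h := hP.continuousAlternatingMap_apply (g := fun i z => ![ξ z, η z] i)
    (g' := ![ξ', η']) (fun i => by fin_cases i <;> simpa)
  refine ⟨_, h, fun u => ?_⟩
  have h0 : Function.update ![ξ y, η y] 0 (ξ' u) = ![ξ' u, η y] := by
    ext i : 1; fin_cases i <;> rfl
  have h1 : Function.update ![ξ y, η y] 1 (η' u) = ![ξ y, η' u] := by
    ext i : 1; fin_cases i <;> rfl
  simp [h0, h1, add_assoc]

/-- Covectors are the alternating forms of degree one. -/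
def covectorFormIsometry : Covector E ≃ₗᵢ[ℝ] (E [⋀^Fin 1]→L[ℝ] ℝ) :=
  ContinuousAlternatingMap.ofSubsingletonLIE (𝕜 := ℝ) (E := E) (F := ℝ) (0 : Fin 1)

theorem differentiableAt_covectorForm_iff {η : E → Covector E} {y : E} :
    DifferentiableAt ℝ (fun z => covectorForm (η z)) y ↔ DifferentiableAt ℝ η y :=
  (covectorFormIsometry (E := E)).toContinuousLinearEquiv.comp_differentiableAt_iff

theorem extDeriv_covectorForm_apply {η : E → Covector E} {y : E} (hη : DifferentiableAt ℝ η y)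
    (v w : E) :
    extDeriv (fun z => covectorForm (η z)) y ![v, w] = fderiv ℝ η y v w - fderiv ℝ η y w v := by
  have h (u : E) : HasFDerivAt (fun z => η z u) ((fderiv ℝ η y).flip u) y :=
    (ContinuousLinearMap.apply ℝ ℝ u).hasFDerivAt.comp y hη.hasFDerivAt
  have h0 : Fin.removeNth 0 ![v, w] 0 = w := rfl
  have h1 : Fin.removeNth 1 ![v, w] 0 = v := rfl
  rw [extDeriv_apply (differentiableAt_covectorForm_iff.2 hη)]
  simp [covectorForm, Fin.sum_univ_two, h0, h1, (h _).fderiv, sub_eq_add_neg]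

variable [FiniteDimensional ℝ E]

theorem differentiableAt_of_apply {F : Type*} [NormedAddCommGroup F] [NormedSpace ℝ F]
    {X : F → E} {y : F}
    (h : ∀ α : Covector E, DifferentiableAt ℝ (fun z => α (X z)) y) : DifferentiableAt ℝ X y := by
  let e := (Module.finBasis ℝ E).equivFun.toContinuousLinearEquiv
  rw [← e.comp_differentiableAt_iff, differentiableAt_pi]
  intro i
  exact h ((ContinuousLinearMap.proj (R := ℝ) (φ := fun _ => ℝ) i).comp (e : E →L[ℝ] _))

/-- For equal arguments the two summands of `schoutenVec` coincide; this is the factor `2` that `½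
[P, P]_SN` removes. -/
theorem schoutenVec_self_apply (P : E → Bivector E) (y : E) (a b c : Covector E) :
    schoutenVec P P y ![a, b, c] = 2 * (fderiv ℝ P y (sharp (P y) a) ![b, c]
      - fderiv ℝ P y (sharp (P y) b) ![a, c] + fderiv ℝ P y (sharp (P y) c) ![a, b]) := by
  have h0 : Fin.removeNth 0 ![a, b, c] = ![b, c] := by
    ext i : 1; fin_cases i <;> rfl
  have h1 : Fin.removeNth 1 ![a, b, c] = ![a, c] := by
    ext i : 1; fin_cases i <;> rfl
  have h2 : Fin.removeNth 2 ![a, b, c] = ![a, b] := by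
    ext i : 1; fin_cases i <;> rfl
  simp [schoutenVec, ContinuousAlternatingMap.alternatizeUncurryFin_apply, Fin.sum_univ_three,
    h0, h1, h2]
  ring

/-- The Koszul bracket of two `1`-forms on a vector space. -/
def koszulVec (P : E → Bivector E) (ξ η : E → Covector E) (y : E) : Covector E :=
  interiorTwo (sharp (P y) (ξ y)) (extDeriv (fun z => covectorForm (η z)) y)
      + fderiv ℝ (fun z => η z (sharp (P z) (ξ z))) y
    - (interiorTwo (sharp (P y) (η y)) (extDeriv (fun z => covectorForm (ξ z)) y)
      + fderiv ℝ (fun z => ξ z (sharp (P z) (η z))) y)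
    - fderiv ℝ (fun z => P z ![ξ z, η z]) y

theorem differentiableAt_sharp {P : E → Bivector E} {ξ : E → Covector E} {y : E}
    (hP : DifferentiableAt ℝ P y) (hξ : DifferentiableAt ℝ ξ y) :
    DifferentiableAt ℝ (fun z => sharp (P z) (ξ z)) y := by
  refine differentiableAt_of_apply fun α => ?_
  obtain ⟨D, hD, -⟩ := hasFDerivAt_bivector_apply hP.hasFDerivAt hξ.hasFDerivAt
    (hasFDerivAt_const α y)
  simp only [apply_sharp]
  exact hD.differentiableAt

theorem apply_fderiv_sharp {P : E → Bivector E} {ξ : E → Covector E} {y : E}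
    (hP : DifferentiableAt ℝ P y) (hξ : DifferentiableAt ℝ ξ y) (α : Covector E) (u : E) :
    α (fderiv ℝ (fun z => sharp (P z) (ξ z)) y u) =
      fderiv ℝ P y u ![ξ y, α] + P y ![fderiv ℝ ξ y u, α] := by
  obtain ⟨D, hD, hDu⟩ := hasFDerivAt_bivector_apply hP.hasFDerivAt hξ.hasFDerivAt
    (hasFDerivAt_const α y)
  have h : HasFDerivAt (fun z => α (sharp (P z) (ξ z))) _ y :=
    α.hasFDerivAt.comp y (differentiableAt_sharp hP hξ).hasFDerivAt
  simp only [apply_sharp] at h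
  have h2 := congrArg (fun L => L u) (h.unique hD)
  have h3 : P y ![ξ y, 0] = 0 := by simpa using bivector_smul_right (P y) 0 (ξ y) 0
  simpa [hDu, h3] using h2

/-- With `D = d(P(ξ, η))`, the three exact terms add up to `D - (-D) - D = D`. Expanding `D u` by
Leibniz, the terms `P(ξ' u, η)` and `P(ξ, η' u)` cancel against half of `dξ` and `dη`. -/
theorem koszulVec_apply {P : E → Bivector E} {ξ η : E → Covector E} {y : E}
    (hP : DifferentiableAt ℝ P y) (hξ : DifferentiableAt ℝ ξ y) (hη : DifferentiableAt ℝ η y)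
    (u : E) :
    koszulVec P ξ η y u = fderiv ℝ η y (sharp (P y) (ξ y)) u
      - fderiv ℝ ξ y (sharp (P y) (η y)) u + fderiv ℝ P y u ![ξ y, η y] := by
  obtain ⟨D, hD, hDu⟩ := hasFDerivAt_bivector_apply hP.hasFDerivAt hξ.hasFDerivAt hη.hasFDerivAt
  have h1 : fderiv ℝ (fun z => η z (sharp (P z) (ξ z))) y = D := by
    simp only [apply_sharp]
    exact hD.fderiv
  have h2 : fderiv ℝ (fun z => ξ z (sharp (P z) (η z))) y = -D := by
    simp only [apply_sharp]
    rw [← hD.neg.fderiv]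
    congr 1
    ext z
    exact bivector_swap _ _ _
  have h3 : P y ![fderiv ℝ ξ y u, η y] = -fderiv ℝ ξ y u (sharp (P y) (η y)) := by
    rw [bivector_swap, apply_sharp]
  rw [koszulVec, h1, h2, hD.fderiv]
  simp only [sub_apply, add_apply, neg_apply, interiorTwo_apply,
    extDeriv_covectorForm_apply hξ, extDeriv_covectorForm_apply hη, hDu, h3]
  rw [← apply_sharp (P y) (ξ y) (fderiv ℝ η y u)]
  ring

/-- The failure of `P^♯` to intertwine the Koszul bracket and the Lie bracket is
`½ [P, P]_SN`. -/
theorem lieBracket_sharp_sub_sharp_koszulVec {P : E → Bivector E} {ξ η : E → Covector E} {y : E}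
    (hP : DifferentiableAt ℝ P y) (hξ : DifferentiableAt ℝ ξ y) (hη : DifferentiableAt ℝ η y)
    (γ : Covector E) :
    γ (VectorField.lieBracket ℝ (fun z => sharp (P z) (ξ z)) (fun z => sharp (P z) (η z)) y)
      - P y ![koszulVec P ξ η y, γ] = 1 / 2 * schoutenVec P P y ![ξ y, η y, γ] := by
  -- Skewness turns `P(κ, γ)` into `-κ(P♯γ)`, so the formula for the Koszul bracket `κ` is needed
  -- only in the direction `u = P♯γ`.
  rw [bivector_swap, ← apply_sharp, koszulVec_apply hP hξ hη, schoutenVec_self_apply,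
    VectorField.lieBracket, map_sub, apply_fderiv_sharp hP hξ, apply_fderiv_sharp hP hη,
    bivector_swap (P y) _ γ, bivector_swap (P y) _ γ]
  simp only [apply_sharp]
  ring

end Flat

/-! ### Transport to the manifold through the preferred chart. -/

section Chart

variable {E : Type*} [NormedAddCommGroup E] [NormedSpace ℝ E]
  {M : Type*} [TopologicalSpace M] [ChartedSpace E M]

/-- The expression of a covector field in the preferred chart at `x₀`. -/
def chartCovector (ξ : CovectorField E M) (x₀ : M) (y : E) : Covector E :=
  (ξ ((extChartAt 𝓘(ℝ, E) x₀).symm y)).comp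
    (mfderiv 𝓘(ℝ, E) 𝓘(ℝ, E) (extChartAt 𝓘(ℝ, E) x₀).symm y)

theorem chartForm_toForm (ξ : CovectorField E M) (x₀ : M) :
    chartForm (toForm ξ) x₀ = fun y => covectorForm (chartCovector ξ x₀ y) := by
  ext y v
  rfl

theorem target_mem_nhds (x₀ : M) :
    (extChartAt 𝓘(ℝ, E) x₀).target ∈ 𝓝 (extChartAt 𝓘(ℝ, E) x₀ x₀) :=
  extChartAt_target_mem_nhds x₀

theorem SmoothBivector.differentiableAt {P : BivectorField E M} (hP : SmoothBivector P) (x₀ : M) :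
    DifferentiableAt ℝ (chartBivector P x₀) (extChartAt 𝓘(ℝ, E) x₀ x₀) :=
  ((hP x₀).contDiffAt (target_mem_nhds x₀)).differentiableAt (by simp)

theorem SmoothOneForm.differentiableAt {ξ : CovectorField E M} (hξ : SmoothOneForm ξ) (x₀ : M) :
    DifferentiableAt ℝ (chartCovector ξ x₀) (extChartAt 𝓘(ℝ, E) x₀ x₀) := by
  have h := ((hξ x₀).contDiffAt (target_mem_nhds x₀)).differentiableAt (by simp)
  rwa [chartForm_toForm, differentiableAt_covectorForm_iff] at h

/-- The derivative at `x₀` of the preferred chart at `x₀`. -/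
def chartDeriv (x₀ : M) : TangentSpace 𝓘(ℝ, E) x₀ →L[ℝ] E :=
  mfderiv 𝓘(ℝ, E) 𝓘(ℝ, E) (extChartAt 𝓘(ℝ, E) x₀) x₀

theorem chartBivector_apply_self (P : BivectorField E M) (x₀ : M) (a b : Covector E) :
    chartBivector P x₀ (extChartAt 𝓘(ℝ, E) x₀ x₀) ![a, b] =
      P x₀ ![a.comp (chartDeriv x₀), b.comp (chartDeriv x₀)] := by
  -- The base point is generalized because `φ⁻¹ (φ x₀) = x₀` is not definitional and the tangent
  -- space depends on it.
  have key : ∀ (x : M) (hx : (extChartAt 𝓘(ℝ, E) x₀).symm (extChartAt 𝓘(ℝ, E) x₀ x₀) = x),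
      chartBivector P x₀ (extChartAt 𝓘(ℝ, E) x₀ x₀) ![a, b] =
        P x ![a.comp (mfderiv 𝓘(ℝ, E) 𝓘(ℝ, E) (extChartAt 𝓘(ℝ, E) x₀) x :
          TangentSpace 𝓘(ℝ, E) x →L[ℝ] E), b.comp (mfderiv 𝓘(ℝ, E) 𝓘(ℝ, E)
            (extChartAt 𝓘(ℝ, E) x₀) x : TangentSpace 𝓘(ℝ, E) x →L[ℝ] E)] := by
    rintro x rfl
    refine congrArg (P _) ?_
    ext i : 1
    fin_cases i <;> rfl
  exact key x₀ (extChartAt_to_inv x₀)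

theorem interiorTwo_compContinuousLinearMap (θ : E [⋀^Fin 2]→L[ℝ] ℝ) {x : M}
    (A : TangentSpace 𝓘(ℝ, E) x →L[ℝ] E) (v : TangentSpace 𝓘(ℝ, E) x) :
    interiorTwo v (θ.compContinuousLinearMap A) = (interiorTwo (A v) θ).comp A := by
  ext w
  rw [interiorTwo_apply, ContinuousLinearMap.comp_apply, interiorTwo_apply]
  refine congrArg θ ?_
  ext i : 1
  fin_cases i <;> rfl

variable [IsManifold 𝓘(ℝ, E) ∞ M]

theorem mfderiv_symm_apply_mfderiv {x₀ x : M} {y : E} (hy : y ∈ (extChartAt 𝓘(ℝ, E) x₀).target)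
    (hx : (extChartAt 𝓘(ℝ, E) x₀).symm y = x) (v : TangentSpace 𝓘(ℝ, E) x) :
    mfderiv 𝓘(ℝ, E) 𝓘(ℝ, E) (extChartAt 𝓘(ℝ, E) x₀).symm y
      (mfderiv 𝓘(ℝ, E) 𝓘(ℝ, E) (extChartAt 𝓘(ℝ, E) x₀) x v) = v := by
  subst hx
  have h := mfderivWithin_extChartAt_symm_comp_mfderiv_extChartAt (I := 𝓘(ℝ, E)) hy
  rw [ModelWithCorners.range_eq_univ, mfderivWithin_univ] at h
  exact DFunLike.congr_fun h v

theorem isInvertible_chartDeriv (x₀ : M) : (chartDeriv (E := E) x₀).IsInvertible :=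
  isInvertible_mfderiv_extChartAt (mem_extChartAt_source x₀)

theorem chartCovector_comp_chartDeriv (ξ : CovectorField E M) (x₀ : M) :
    (chartCovector ξ x₀ (extChartAt 𝓘(ℝ, E) x₀ x₀)).comp (chartDeriv x₀) = ξ x₀ := by
  have key : ∀ (x : M) (hx : (extChartAt 𝓘(ℝ, E) x₀).symm (extChartAt 𝓘(ℝ, E) x₀ x₀) = x),
      (chartCovector ξ x₀ (extChartAt 𝓘(ℝ, E) x₀ x₀)).comp
        (mfderiv 𝓘(ℝ, E) 𝓘(ℝ, E) (extChartAt 𝓘(ℝ, E) x₀) x :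
          TangentSpace 𝓘(ℝ, E) x →L[ℝ] E) = ξ x := by
    rintro x rfl
    ext v
    exact congrArg (ξ _) (mfderiv_symm_apply_mfderiv (mem_extChartAt_target x₀) rfl v)
  exact key x₀ (extChartAt_to_inv x₀)

theorem differential_eq_fderiv_comp {f : M → ℝ} {g : E → ℝ} {x₀ : M}
    (hg : DifferentiableAt ℝ g (extChartAt 𝓘(ℝ, E) x₀ x₀))
    (hfg : ∀ y ∈ (extChartAt 𝓘(ℝ, E) x₀).target, f ((extChartAt 𝓘(ℝ, E) x₀).symm y) = g y) :
    differential (E := E) f x₀ = (fderiv ℝ g (extChartAt 𝓘(ℝ, E) x₀ x₀)).comp (chartDeriv x₀) := by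
  have h : f =ᶠ[𝓝 x₀] g ∘ extChartAt 𝓘(ℝ, E) x₀ := by
    filter_upwards [extChartAt_source_mem_nhds (I := 𝓘(ℝ, E)) x₀] with x hx
    rw [Function.comp_apply, ← hfg _ ((extChartAt 𝓘(ℝ, E) x₀).map_source hx),
      (extChartAt 𝓘(ℝ, E) x₀).left_inv hx]
  have h2 := mfderiv_comp x₀ hg.mdifferentiableAt
    (mdifferentiableAt_extChartAt (I := 𝓘(ℝ, E)) (mem_chart_source E x₀))
  rw [mfderiv_eq_fderiv] at h2
  exact h.mfderiv_eq.trans h2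

variable [FiniteDimensional ℝ E]

/-- `P^♯` commutes with passing to a chart. -/
theorem sharp_chartBivector (P : BivectorField E M) (ξ : CovectorField E M) {x₀ : M} {y : E}
    (hy : y ∈ (extChartAt 𝓘(ℝ, E) x₀).target) :
    sharp (chartBivector P x₀ y) (chartCovector ξ x₀ y) =
      mfderiv 𝓘(ℝ, E) 𝓘(ℝ, E) (extChartAt 𝓘(ℝ, E) x₀) ((extChartAt 𝓘(ℝ, E) x₀).symm y)
        (sharpField P ξ ((extChartAt 𝓘(ℝ, E) x₀).symm y)) := by
  refine eq_of_forall_covector fun α => ?_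
  rw [apply_sharp]
  refine Eq.trans ?_ (apply_sharp (P ((extChartAt 𝓘(ℝ, E) x₀).symm y)) _
    (α.comp (mfderiv 𝓘(ℝ, E) 𝓘(ℝ, E) (extChartAt 𝓘(ℝ, E) x₀)
        ((extChartAt 𝓘(ℝ, E) x₀).symm y) :
          TangentSpace 𝓘(ℝ, E) ((extChartAt 𝓘(ℝ, E) x₀).symm y) →L[ℝ] E))).symm
  refine congrArg (P _) ?_
  ext i : 1
  fin_cases i
  · ext v
    exact congrArg (ξ _) (mfderiv_symm_apply_mfderiv hy rfl v)
  · rfl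

theorem sharp_chartBivector_self (P : BivectorField E M) (ξ : CovectorField E M) (x₀ : M) :
    sharp (chartBivector P x₀ (extChartAt 𝓘(ℝ, E) x₀ x₀))
      (chartCovector ξ x₀ (extChartAt 𝓘(ℝ, E) x₀ x₀)) = chartDeriv x₀ (sharpField P ξ x₀) := by
  refine eq_of_forall_covector fun α => ?_
  rw [apply_sharp, chartBivector_apply_self, chartCovector_comp_chartDeriv]
  exact (apply_sharp (P x₀) (ξ x₀) (α.comp (chartDeriv x₀))).symm

theorem chartDeriv_mlieBracket (P : BivectorField E M) (ξ η : CovectorField E M) (x₀ : M) :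
    chartDeriv x₀ (VectorField.mlieBracket 𝓘(ℝ, E) (sharpField P ξ) (sharpField P η) x₀) =
      VectorField.lieBracket ℝ (fun y => sharp (chartBivector P x₀ y) (chartCovector ξ x₀ y))
        (fun y => sharp (chartBivector P x₀ y) (chartCovector η x₀ y))
        (extChartAt 𝓘(ℝ, E) x₀ x₀) := by
  -- The Lie bracket depends only on germs, so agreement of the fields on the chart target suffices.
  have key (ζ : CovectorField E M) :
      (VectorField.mpullback 𝓘(ℝ, E) 𝓘(ℝ, E) (extChartAt 𝓘(ℝ, E) x₀).symm
        (sharpField P ζ) : E → E) =ᶠ[𝓝 (extChartAt 𝓘(ℝ, E) x₀ x₀)]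
      fun y => sharp (chartBivector P x₀ y) (chartCovector ζ x₀ y) := by
    filter_upwards [target_mem_nhds x₀] with y hy
    have hinv := isInvertible_mfderivWithin_extChartAt_symm (I := 𝓘(ℝ, E)) hy
    rw [ModelWithCorners.range_eq_univ, mfderivWithin_univ] at hinv
    rw [sharp_chartBivector P ζ hy]
    refine (hinv.inverse_apply_eq).2 ?_
    exact (mfderiv_symm_apply_mfderiv hy rfl _).symm
  rw [← VectorField.mlieBracketWithin_univ, VectorField.mlieBracketWithin_apply]
  refine ((isInvertible_chartDeriv x₀).self_apply_inverse _).trans ?_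
  rw [ModelWithCorners.range_eq_univ, VectorField.mpullbackWithin_univ,
    VectorField.mpullbackWithin_univ, Set.preimage_univ, Set.univ_inter]
  refine Eq.trans ?_ ((key ξ).lieBracket_vectorField_eq (key η))
  exact congrFun VectorField.lieBracketWithin_univ _

theorem apply_sharpField_symm (P : BivectorField E M) (ξ η : CovectorField E M) {x₀ : M} {y : E}
    (hy : y ∈ (extChartAt 𝓘(ℝ, E) x₀).target) :
    η ((extChartAt 𝓘(ℝ, E) x₀).symm y) (sharpField P ξ ((extChartAt 𝓘(ℝ, E) x₀).symm y)) =
      chartCovector η x₀ y (sharp (chartBivector P x₀ y) (chartCovector ξ x₀ y)) := by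
  rw [sharp_chartBivector P ξ hy]
  exact congrArg (η _) (mfderiv_symm_apply_mfderiv hy rfl _).symm

theorem lieDerivative_sharpField {P : BivectorField E M} (hP : SmoothBivector P)
    {ξ η : CovectorField E M} (hξ : SmoothOneForm ξ) (hη : SmoothOneForm η) (x₀ : M) :
    lieDerivative (sharpField P ξ) η x₀ =
      (interiorTwo (sharp (chartBivector P x₀ (extChartAt 𝓘(ℝ, E) x₀ x₀))
            (chartCovector ξ x₀ (extChartAt 𝓘(ℝ, E) x₀ x₀)))
          (extDeriv (fun z => covectorForm (chartCovector η x₀ z)) (extChartAt 𝓘(ℝ, E) x₀ x₀))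
        + fderiv ℝ (fun z => chartCovector η x₀ z (sharp (chartBivector P x₀ z)
            (chartCovector ξ x₀ z))) (extChartAt 𝓘(ℝ, E) x₀ x₀)).comp (chartDeriv x₀) := by
  rw [ContinuousLinearMap.add_comp, sharp_chartBivector_self,
    ← interiorTwo_compContinuousLinearMap, ← chartForm_toForm]
  -- The `dη` terms agree by definition: `mextDeriv` at `x₀` is computed in this same chart.
  refine congrArg₂ (· + ·) rfl (differential_eq_fderiv_comp ?_ fun y hy =>
    apply_sharpField_symm P ξ η hy)
  exact (hη.differentiableAt x₀).clm_apply
    (differentiableAt_sharp (hP.differentiableAt x₀) (hξ.differentiableAt x₀))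

theorem koszulBracket_eq_koszulVec_comp {P : BivectorField E M} (hP : SmoothBivector P)
    {ξ η : CovectorField E M} (hξ : SmoothOneForm ξ) (hη : SmoothOneForm η) (x₀ : M) :
    koszulBracket P ξ η x₀ = (koszulVec (chartBivector P x₀) (chartCovector ξ x₀)
      (chartCovector η x₀) (extChartAt 𝓘(ℝ, E) x₀ x₀)).comp (chartDeriv x₀) := by
  rw [koszulBracket, lieDerivative_sharpField hP hξ hη, lieDerivative_sharpField hP hη hξ,
    koszulVec, ContinuousLinearMap.sub_comp, ContinuousLinearMap.sub_comp]
  refine congrArg₂ (· - ·) rfl (differential_eq_fderiv_comp ?_ fun y hy => ?_)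
  · obtain ⟨D, hD, -⟩ := hasFDerivAt_bivector_apply (hP.differentiableAt x₀).hasFDerivAt
      (hξ.differentiableAt x₀).hasFDerivAt (hη.differentiableAt x₀).hasFDerivAt
    exact hD.differentiableAt
  · rw [← apply_sharp, ← apply_sharp]
    exact apply_sharpField_symm P ξ η hy

/-- The failure of `P^♯` to intertwine the Koszul bracket and the Lie bracket is
`½ [P, P]_SN`. -/
theorem apply_mlieBracket_sub_sharp_koszulBracket {P : BivectorField E M} (hP : SmoothBivector P)
    {ξ η : CovectorField E M} (hξ : SmoothOneForm ξ) (hη : SmoothOneForm η) (x₀ : M)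
    (γ : Covector (TangentSpace 𝓘(ℝ, E) x₀)) :
    γ (VectorField.mlieBracket 𝓘(ℝ, E) (sharpField P ξ) (sharpField P η) x₀)
      - γ (sharp (P x₀) (koszulBracket P ξ η x₀)) =
        1 / 2 * schouten P P x₀ ![ξ x₀, η x₀, γ] := by
  have hinv := isInvertible_chartDeriv (E := E) x₀
  have hcomp (ζ : CovectorField E M) : (ζ x₀).comp (chartDeriv x₀).inverse =
      chartCovector ζ x₀ (extChartAt 𝓘(ℝ, E) x₀ x₀) := by
    rw [← chartCovector_comp_chartDeriv ζ x₀, ContinuousLinearMap.comp_assoc,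
      hinv.self_comp_inverse, ContinuousLinearMap.comp_id]
  obtain ⟨δ, rfl⟩ : ∃ δ : Covector E, δ.comp (chartDeriv x₀) = γ :=
    ⟨γ.comp (chartDeriv x₀).inverse, by
      rw [ContinuousLinearMap.comp_assoc, hinv.inverse_comp_self, ContinuousLinearMap.comp_id]⟩
  have h := lieBracket_sharp_sub_sharp_koszulVec (hP.differentiableAt x₀) (hξ.differentiableAt x₀)
    (hη.differentiableAt x₀) δ
  rw [← chartDeriv_mlieBracket, chartBivector_apply_self,
    ← koszulBracket_eq_koszulVec_comp hP hξ hη, ← apply_sharp] at h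
  refine h.trans ?_
  congr 1
  refine congrArg (schoutenVec (chartBivector P x₀) (chartBivector P x₀) _) ?_
  ext i : 1
  fin_cases i
  · exact (hcomp ξ).symm
  · exact (hcomp η).symm
  · change δ = (δ.comp (chartDeriv x₀)).comp (chartDeriv x₀).inverse
    rw [ContinuousLinearMap.comp_assoc, hinv.self_comp_inverse, ContinuousLinearMap.comp_id]

end Chart

/-! ### Extending a covector to a global smooth `1`-form. -/

section Extension

variable {E : Type*} [NormedAddCommGroup E] [NormedSpace ℝ E]
  {M : Type*} [TopologicalSpace M] [ChartedSpace E M] [IsManifold 𝓘(ℝ, E) ∞ M]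

theorem smoothOneForm_differential {f : M → ℝ} (hf : ContMDiff 𝓘(ℝ, E) 𝓘(ℝ, ℝ) ∞ f) :
    SmoothOneForm (differential (E := E) f) := by
  intro x₀
  have ho : IsOpen (extChartAt 𝓘(ℝ, E) x₀).target := isOpen_extChartAt_target x₀
  have hg : ContDiffOn ℝ ∞ (f ∘ (extChartAt 𝓘(ℝ, E) x₀).symm) (extChartAt 𝓘(ℝ, E) x₀).target :=
    contMDiffOn_iff_contDiffOn.1 (hf.comp_contMDiffOn (contMDiffOn_extChartAt_symm x₀))
  rw [chartForm_toForm]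
  refine covectorFormIsometry.toContinuousLinearEquiv.contDiff.comp_contDiffOn
    ((hg.fderiv_of_isOpen ho (m := ∞) (by simp)).congr fun y hy => ?_)
  have h := mdifferentiableWithinAt_extChartAt_symm (I := 𝓘(ℝ, E)) hy
  rw [ModelWithCorners.range_eq_univ, mdifferentiableWithinAt_univ] at h
  rw [← mfderiv_eq_fderiv]
  exact (mfderiv_comp y ((hf _).mdifferentiableAt (by simp)) h).symm

/-- An exact form is enough: the differential of a linear function of the chart, cut off by a bump
function equal to `1` near `x₀`. -/
theorem exists_smoothOneForm_eq [FiniteDimensional ℝ E] [T2Space M] (x₀ : M)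
    (a : Covector (TangentSpace 𝓘(ℝ, E) x₀)) :
    ∃ ξ : CovectorField E M, SmoothOneForm ξ ∧ ξ x₀ = a := by
  let b : Covector E := a.comp (chartDeriv x₀).inverse
  let χ : SmoothBumpFunction 𝓘(ℝ, E) x₀ := Classical.arbitrary _
  have hb : ContMDiffOn 𝓘(ℝ, E) 𝓘(ℝ, ℝ) ∞ (fun x => b (extChartAt 𝓘(ℝ, E) x₀ x))
      (chartAt E x₀).source :=
    b.contDiff.contMDiff.comp_contMDiffOn contMDiffOn_extChartAt
  refine ⟨differential fun x => χ x • b (extChartAt 𝓘(ℝ, E) x₀ x),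
    smoothOneForm_differential (χ.contMDiff_smul hb), ?_⟩
  have h : (fun x => χ x • b (extChartAt 𝓘(ℝ, E) x₀ x)) =ᶠ[𝓝 x₀] b ∘ extChartAt 𝓘(ℝ, E) x₀ := by
    filter_upwards [χ.eventuallyEq_one] with x hx
    simp [hx]
  have h2 := mfderiv_comp x₀ b.differentiableAt.mdifferentiableAt
    (mdifferentiableAt_extChartAt (I := 𝓘(ℝ, E)) (mem_chart_source E x₀))
  rw [mfderiv_eq_fderiv, b.fderiv] at h2
  refine (h.mfderiv_eq.trans h2).trans ?_
  change b.comp (chartDeriv x₀) = a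
  rw [ContinuousLinearMap.comp_assoc, (isInvertible_chartDeriv x₀).inverse_comp_self,
    ContinuousLinearMap.comp_id]

end Extension

/-! ### The identity with background. -/

section Background

variable {E : Type*} [NormedAddCommGroup E] [NormedSpace ℝ E] [FiniteDimensional ℝ E]
  {M : Type*} [TopologicalSpace M] [ChartedSpace E M] [IsManifold 𝓘(ℝ, E) ∞ M]

theorem apply_mlieBracket_sub_sharp_twistedBracket {P : BivectorField E M}
    (hP : SmoothBivector P) (ψ : FormField E M 3) {ξ η : CovectorField E M}
    (hξ : SmoothOneForm ξ) (hη : SmoothOneForm η) (x : M)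
    (γ : Covector (TangentSpace 𝓘(ℝ, E) x)) :
    γ (VectorField.mlieBracket 𝓘(ℝ, E) (sharpField P ξ) (sharpField P η) x)
      - γ (sharpField P (twistedBracket P ψ ξ η) x) =
        1 / 2 * schouten P P x ![ξ x, η x, γ]
          - wedgeThreeSharp (P x) (ψ x) ![ξ x, η x, γ] := by
  have h := apply_mlieBracket_sub_sharp_koszulBracket hP hξ hη x γ
  have h2 := apply_sharp_interiorWedge (P x) (ψ x) (ξ x) (η x) γ
  rw [sharpField, twistedBracket, map_add, map_add, sharpField, sharpField]
  linarith

end Background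

end PoissonBackground

end

theorem mainTheorem7 {E : Type*} [NormedAddCommGroup E] [NormedSpace ℝ E] [FiniteDimensional ℝ E]
    {M : Type*} [TopologicalSpace M] [T2Space M] [ChartedSpace E M] [IsManifold 𝓘(ℝ, E) ∞ M]
    (P : PoissonBackground.BivectorField E M) (hP : PoissonBackground.SmoothBivector P)
    (ψ : PoissonBackground.FormField E M 3) (hψ : PoissonBackground.SmoothForm ψ) :
    (∀ ξ η : PoissonBackground.CovectorField E M,
      PoissonBackground.SmoothOneForm ξ → PoissonBackground.SmoothOneForm η →
        PoissonBackground.sharpField P (PoissonBackground.twistedBracket P ψ ξ η) =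
          VectorField.mlieBracket 𝓘(ℝ, E) (PoissonBackground.sharpField P ξ)
            (PoissonBackground.sharpField P η)) ↔
      PoissonBackground.IsPoissonWithBackground P ψ := by
  constructor
  · intro h x
    ext v
    -- Only the first two arguments are differentiated in the brackets; `v 2` is merely paired with
    -- vectors at `x` and needs no extension.
    obtain ⟨ξ, hξ, hξv⟩ := PoissonBackground.exists_smoothOneForm_eq x (v 0)
    obtain ⟨η, hη, hηv⟩ := PoissonBackground.exists_smoothOneForm_eq x (v 1)
    have key := PoissonBackground.apply_mlieBracket_sub_sharp_twistedBracket hP ψ hξ hη x (v 2)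
    rw [← congrFun (h ξ η hξ hη) x, sub_self, hξv, hηv] at key
    have hv : ![v 0, v 1, v 2] = v := by
      ext i : 1
      fin_cases i <;> rfl
    rw [hv] at key
    exact (sub_eq_zero.1 key.symm)
  · intro h ξ η hξ hη
    funext x
    refine PoissonBackground.eq_of_forall_covector fun γ => (sub_eq_zero.1 ?_).symm
    rw [PoissonBackground.apply_mlieBracket_sub_sharp_twistedBracket hP ψ hξ hη x γ, ← h x,
      sub_eq_zero]
    rfl
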